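/- Graphs are finite and simple, $N_G(v)$ is the neighbourhood of $v$, $\oplus$ is symmetric difference, and $Odd_G(S)$ is the set of vertices adjacent to an odd number of elements of $S$. An open graph $(G,I,O)$ is a graph $G=(V,E)$ with sets $I,O\subset V$ (inputs, outputs). For a state $|\phi\rangle$ of the qubits in $I$, the open graph state is $$|G\rangle_\phi=\prod_{\{u,v\}\in E}\mathrm{CZ}_{u;v}\,|\phi\rangle_I|+\rangle_{I^C}.$$ A gflow of $(G,I,O)$ is a pair $(g,\prec)$ of a function $g:O^C\to 2^{I^C}$ and a strict partial order $\prec$ on $V$ such that for all $u\in O^C$: $u\prec v$ for all $v\in g(u)$; $u\in Odd_G(g(u))$; and every $v\in Odd_G(g(u))$ satisfies $v=u$ or $u\prec v$. A flow is a pair $(f,\prec)$ of a function $f:O^C\to I^C$ and a strict partial order $\prec$ such that for all $u\in O^C$: $u\prec f(u)$; $u\in N_G(f(u))$; and every $v\in N_G(f(u))$ satisfies $v=u$ or $u\prec v$. The layers of $(g,\prec)$ are $V_k^\prec=\max_\prec\bigl(V\setminus\bigcup_{i<k}V_i^\prec\bigr)$, $k\ge 0$. A gflow $(g',\prec')$ is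 more delayed than $(g,\prec)$ if $\bigl|\bigcup_{i\le k}V_i^{\prec'}\bigr|\ge\bigl|\bigcup_{i\le k}V_i^{\prec}\bigr|$ for all $k$, with strict inequality for some $k$; a gflow is maximally delayed if no gflow of $(G,I,O)$ is more delayed than it. Let $(g,\prec)$ be a maximally delayed gflow of $(G,I,O)$. A matching gflow $(g_V,\prec_V)$ with successor function $h:V_1^\prec\to O$ is obtained as follows. Enumerate $V_1^\prec=\{v_1,\dots,v_n\}$. For $m=1,\dots,n$ in turn, put $R_{m-1}=\{h(v_1),\dots,h(v_{m-1})\}$, take $U_m\subset\{v_1,\dots,v_{m-1}\}$ with $R_{m-1}\cap g(v_m)=R_{m-1}\cap\bigoplus_{u\in U_m}g(u)$, set $g_V(v_m)=g(v_m)\oplus\bigoplus_{u\in U_m}g(u)$, and choose $h(v_m)\in g_V(v_m)\cap N_G(v_m)$. Off $V_1^\prec$ let $g_V=g$, and let $\prec_V$ be the transitive relation generated by $\prec$ and the relations $v_m\prec_V u$ for $u\in U_m\cup O$, $1\le m\le n$. Put $R_V=\{h(v_1),\dots,h(v_n)\}$. Let $G'$ be $G$ with all edges inside $O$ removed. Then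 for every $\phi$ $$\prod_{\{u,v\}\in E,\;u,v\in O}\mathrm{CZ}_{u;v}\,|G'\rangle_\phi=|G\rangle_\phi .$$ Moreover, for every matching gflow $(g_V,\prec_V)$ built from $(g,\prec)$, with enumeration $v_1,\dots,v_n$ and successor function $h$, there is a graph $H$ on $V$ such that: 1. for every $\phi$, $$\mathrm{CX}_{h(v_n);\,g_V(v_n)\oplus\{h(v_n)\}}\cdots\mathrm{CX}_{h(v_1);\,g_V(v_1)\oplus\{h(v_1)\}}\,|G'\rangle_\phi=|H\rangle_\phi ,$$ where $\mathrm{CX}_{v;S}=\prod_{u\in S}\mathrm{CX}_{v;u}$ has control $v$ and targets $S$, and both sides have input set $I$ (and output set $O$); 2. $H$ has no edges between $R_V$ and the complement of $V_1^\prec$; 3. the subgraph of $H$ induced on $V_1^\prec\cup R_V$, with input set $V_1^\prec$ and output set $R_V$, has a flow. -/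

import Mathlib

open scoped symmDiff

namespace GflowToFlow

section Qubits

variable {V : Type*}

/-- The state space of one qubit per element of `V`, in the computational basis: a vector is given
by its amplitudes `⟨x|ψ⟩` at the bit strings `x` (`false` is `|0⟩`, `true` is `|1⟩`). -/
abbrev QState (V : Type*) := (V → Bool) → ℂ

/-- Linear operators on the qubits labelled by `V`. -/
abbrev QOp (V : Type*) := Module.End ℂ (QState V)

/-- The bit string `x` with the bit at `u` flipped. -/
def flipBit [DecidableEq V] (u : V) (x : V → Bool) : V → Bool := Function.update x u (!(x u))

/-- Pauli `X` on qubit `u`. -/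
def pauliX [DecidableEq V] (u : V) : QOp V where
  toFun ψ := fun x => ψ (flipBit u x)
  map_add' _ _ := rfl
  map_smul' _ _ := rfl

/-- Pauli `Z` on qubit `u`. -/
def pauliZ (u : V) : QOp V where
  toFun ψ := fun x => (if x u then -1 else 1) * ψ x
  map_add' ψ χ := by funext x; simp [mul_add]
  map_smul' c ψ := by funext x; simp

/-- `|0⟩⟨0|_v ⊗ 1 + |1⟩⟨1|_v ⊗ A`, for an operator `A` that does not act on qubit `v`. -/
def controlled (v : V) (A : QOp V) : QOp V where
  toFun ψ := fun x => if x v then A ψ x else ψ x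
  map_add' ψ χ := by funext x; by_cases h : x v <;> simp [h]
  map_smul' c ψ := by funext x; by_cases h : x v <;> simp [h]

/-- The gate `CZ_{v;u}`. -/
def CZ (v u : V) : QOp V := controlled v (pauliZ u)

/-- The gate `CX_{v;u}` (CNOT with control `v` and target `u`). -/
def CX [DecidableEq V] (v u : V) : QOp V := controlled v (pauliX u)

theorem CZ_apply (v u : V) (ψ : QState V) (x : V → Bool) :
    CZ v u ψ x = (if x v && x u then -1 else 1) * ψ x := by
  cases hv : x v <;> simp [CZ, controlled, pauliZ, hv]

theorem CX_apply [DecidableEq V] (v u : V) (ψ : QState V) (x : V → Bool) :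
    CX v u ψ x = if x v then ψ (flipBit u x) else ψ x := rfl

theorem CZ_symm (v u : V) : CZ v u = CZ u v := by
  ext1 ψ; funext x
  rw [CZ_apply, CZ_apply, Bool.and_comm]

/-- The gate `CZ` on the two ends of an unordered pair. -/
def edgeCZ (e : Sym2 V) : QOp V := Sym2.lift ⟨CZ, CZ_symm⟩ e

theorem edgeCZ_commute (e e' : Sym2 V) : Commute (edgeCZ e) (edgeCZ e') := by
  induction e with | _ a b
  induction e' with | _ c d
  change CZ a b * CZ c d = CZ c d * CZ a b
  ext1 ψ; funext x
  simp only [Module.End.mul_apply, CZ_apply]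
  ring

theorem flipBit_comm [DecidableEq V] (u w : V) (x : V → Bool) :
    flipBit u (flipBit w x) = flipBit w (flipBit u x) := by
  funext z
  simp only [flipBit, Function.update_apply]
  grind

theorem CX_commute [DecidableEq V] (v u w : V) (hu : u ≠ v) (hw : w ≠ v) : Commute (CX v u) (CX v w) := by
  change CX v u * CX v w = CX v w * CX v u
  ext1 ψ; funext x
  have h1 : flipBit u x v = x v := by simp [flipBit, hu.symm]
  have h2 : flipBit w x v = x v := by simp [flipBit, hw.symm]
  simp only [Module.End.mul_apply, CX_apply, h1, h2, flipBit_comm u w]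
  cases x v <;> simp

/-- The product of the commuting gates `CZ` over a finite set of unordered pairs. -/
def prodCZ (E : Finset (Sym2 V)) : QOp V :=
  E.noncommProd edgeCZ fun e _ e' _ _ => edgeCZ_commute e e'

/-- `CX_{v;S} = ∏_{u ∈ S} CX_{v;u}`, a product of commuting gates, for a set `S` that does not
contain the control `v` (a `v` in `S` would be ignored). -/
def CXSet [DecidableEq V] (v : V) (S : Finset V) : QOp V :=
  (S.erase v).noncommProd (CX v) fun u hu w hw _ =>
    CX_commute v u w (Finset.ne_of_mem_erase hu) (Finset.ne_of_mem_erase hw)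

end Qubits

section GraphStates

variable {V : Type*} [Fintype V] [DecidableEq V]

/-- The finite edge set of `G`. -/
noncomputable def edges (G : SimpleGraph V) : Finset (Sym2 V) := G.edgeSet.toFinite.toFinset

/-- The set of edges of `G` with both ends in `O`. -/
noncomputable def edgesInside (G : SimpleGraph V) (O : Finset V) : Finset (Sym2 V) :=
  (edges G).filter fun e => ∀ w ∈ e, w ∈ O

/-- `G` with all the edges inside `O` removed. -/
def removeInside (G : SimpleGraph V) (O : Finset V) : SimpleGraph V :=
  G.deleteEdges {e | ∀ w ∈ e, w ∈ O}

/-- The amplitudes of `|+⟩`. -/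
noncomputable def plusState (_ : Bool) : ℂ := 1 / (Real.sqrt 2 : ℂ)

/-- `|φ⟩_I |+⟩_{I^C}`: the qubits in `I` are in the joint state `φ`, the others in `|+⟩`. -/
noncomputable def initialState (I : Finset V) (φ : QState I) : QState V :=
  fun x => φ (fun i => x i) * ∏ v ∈ Iᶜ, plusState (x v)

/-- The open graph state `|G⟩_φ = ∏_{{u,v} ∈ E} CZ_{u;v} |φ⟩_I |+⟩_{I^C}`. -/
noncomputable def openGraphState (G : SimpleGraph V) (I : Finset V) (φ : QState I) : QState V :=
  prodCZ (edges G) (initialState I φ)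

end GraphStates

section Flows

/-- `(f, ≺)` is a flow of the open graph `(G, I, O)`. Only the values of `f` off `O` matter. -/
structure IsFlow {W : Type*} (G : SimpleGraph W) (I O : Set W) (f : W → W)
    (prec : W → W → Prop) : Prop where
  irrefl : ∀ u, ¬ prec u u
  trans : ∀ u v w, prec u v → prec v w → prec u w
  maps : ∀ u, u ∉ O → f u ∉ I
  f1 : ∀ u, u ∉ O → prec u (f u)
  f2 : ∀ u, u ∉ O → G.Adj (f u) u
  f3 : ∀ u, u ∉ O → ∀ v, G.Adj (f u) v → u = v ∨ prec u v

/-- The open graph `(G, I, O)` has a flow. -/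
def HasFlow {W : Type*} (G : SimpleGraph W) (I O : Set W) : Prop :=
  ∃ (f : W → W) (prec : W → W → Prop), IsFlow G I O f prec

variable {V : Type*} [Fintype V] [DecidableEq V]

open Classical in
/-- The odd neighbourhood of `S` in `G`. -/
noncomputable def oddNbhd (G : SimpleGraph V) (S : Finset V) : Finset V :=
  Finset.univ.filter fun v => Odd (S.filter fun u => G.Adj u v).card

/-- `⨁_{u ∈ U} g u`: the elements that lie in an odd number of the sets `g u`, `u ∈ U`. -/
def xorSum (U : Finset V) (g : V → Finset V) : Finset V :=
  Finset.univ.filter fun w => Odd (U.filter fun u => w ∈ g u).card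

/-- `(g, ≺)` is a gflow of the open graph `(G, I, O)`. Only the values of `g` off `O` matter. -/
structure IsGflow (G : SimpleGraph V) (I O : Finset V) (g : V → Finset V)
    (prec : V → V → Prop) : Prop where
  irrefl : ∀ u, ¬ prec u u
  trans : ∀ u v w, prec u v → prec v w → prec u w
  maps : ∀ u, u ∉ O → g u ⊆ Iᶜ
  g1 : ∀ u, u ∉ O → ∀ v ∈ g u, prec u v
  g2 : ∀ u, u ∉ O → u ∈ oddNbhd G (g u)
  g3 : ∀ u, u ∉ O → ∀ v ∈ oddNbhd G (g u), u = v ∨ prec u v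

open Classical in
/-- The elements of `X` that are maximal in `X`. -/
noncomputable def maxOf (prec : V → V → Prop) (X : Finset V) : Finset V :=
  X.filter fun u => ∀ v ∈ X, ¬ prec u v

/-- The union of the layers `V_i`, `i < k`. -/
noncomputable def layersBelow (prec : V → V → Prop) : ℕ → Finset V
  | 0 => ∅
  | k + 1 => layersBelow prec k ∪ maxOf prec (layersBelow prec k)ᶜ

/-- The layer `V_k`: the maximal elements of the complement of the earlier layers. -/
noncomputable def layer (prec : V → V → Prop) (k : ℕ) : Finset V :=
  maxOf prec (layersBelow prec k)ᶜ

/-- A gflow with order `prec` is more delayed than one with order `prec'`. -/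
def MoreDelayed (prec prec' : V → V → Prop) : Prop :=
  (∀ k, (layersBelow prec' (k + 1)).card ≤ (layersBelow prec (k + 1)).card) ∧
    ∃ k, (layersBelow prec' (k + 1)).card < (layersBelow prec (k + 1)).card

/-- `(g, ≺)` is a maximally delayed gflow of `(G, I, O)`: a gflow than which no gflow of
`(G, I, O)` is more delayed. -/
def IsMaxDelayedGflow (G : SimpleGraph V) (I O : Finset V) (g : V → Finset V)
    (prec : V → V → Prop) : Prop :=
  IsGflow G I O g prec ∧
    ∀ (g' : V → Finset V) (prec' : V → V → Prop), IsGflow G I O g' prec' →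
      ¬ MoreDelayed prec' prec

/-- `(gV, precV)` is a matching gflow of `(G, I, O)`, with successor function `h`, built from the
gflow `(g, prec)` by going through the vertices `v 0, v 1, …` of the layer `V_1` in this order.
At step `m`, with `R_m = {h (v j) | j < m}`, one takes `U m ⊆ {v j | j < m}` such that
`R_m ∩ g (v m) = R_m ∩ ⨁_{u ∈ U m} g u`, sets `gV (v m) = g (v m) ⊕ ⨁_{u ∈ U m} g u`, chooses
`h (v m)` among the neighbours of `v m` in `gV (v m)`, and adds to the order the relations
`v m ≺ u` for `u ∈ U m ∪ O`. Only the values of `h` on the layer `V_1` matter. -/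
def IsMatchingGflow (G : SimpleGraph V) (O : Finset V) (g : V → Finset V)
    (prec : V → V → Prop) {n : ℕ} (v : Fin n → V) (gV : V → Finset V) (precV : V → V → Prop)
    (h : V → V) : Prop :=
  Function.Injective v ∧ Finset.univ.image v = layer prec 1 ∧
  ∃ U : Fin n → Finset V,
    (∀ m, U m ⊆ (Finset.Iio m).image v) ∧
    (∀ m, (Finset.Iio m).image (fun j => h (v j)) ∩ g (v m) =
      (Finset.Iio m).image (fun j => h (v j)) ∩ xorSum (U m) g) ∧
    (∀ m, gV (v m) = g (v m) ∆ xorSum (U m) g) ∧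
    (∀ w, w ∉ layer prec 1 → gV w = g w) ∧
    (∀ m, h (v m) ∈ gV (v m) ∧ G.Adj (v m) (h (v m))) ∧
    precV = Relation.TransGen fun a b => prec a b ∨ ∃ m, a = v m ∧ b ∈ U m ∪ O

end Flows

end GflowToFlow

/-! Without edges inside `O`, an open graph is given by its part off `O` together with one row over
the field with two elements for each output: its neighbourhood off `O`. A gate `CX` with control `r`
and target `s`, both outputs and `s ∉ I`, adds row `s` to row `r`: the qubit `s` starts in `|+⟩`, so
`X` on it costs only the sign given by the parity of the bits at its neighbours, and controlling
this on `r` toggles edges at `r`.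

The matching condition makes `g (v m)` and the sum over `U m` agree on the earlier successors, so
`gV (v m)` contains none of them. Each round of gates therefore adds rows that are still those of
`G`, and row `h (v m)` becomes the odd neighbourhood of `gV (v m)`.

Maximal delay forces the layer `V_0` to be `O`. Hence for `u` in `V_1` the set `g u` lies in `O`,
and its odd neighbourhood meets the complement of `O` only in `u`. By linearity the new row of `h (v
m)` is `{v m} ∪ U m`, with `U m` among the earlier vertices. This triangular shape is a flow. -/

namespace GflowToFlow

/-! ### Graph states as sign functions on bit strings -/

section Phases

variable {V : Type*}

/-- The sign that `CZ` on the two ends of `e` gives to the basis state `x`. -/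
noncomputable def edgeSign (x : V → Bool) (e : Sym2 V) : ℂ :=
  Sym2.lift ⟨fun a b => if x a && x b then -1 else 1, fun a b => by simp only [Bool.and_comm]⟩ e

@[simp]
theorem edgeSign_mk (x : V → Bool) (a b : V) :
    edgeSign x s(a, b) = if x a && x b then -1 else 1 := rfl

theorem edgeSign_mul_self (x : V → Bool) (e : Sym2 V) : edgeSign x e * edgeSign x e = 1 := by
  induction e with | _ a b
  rw [edgeSign_mk]
  split_ifs <;> norm_num

theorem edgeCZ_apply (e : Sym2 V) (ψ : QState V) (x : V → Bool) :
    edgeCZ e ψ x = edgeSign x e * ψ x := by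
  induction e with | _ a b
  exact CZ_apply a b ψ x

theorem prodCZ_apply (E : Finset (Sym2 V)) (ψ : QState V) (x : V → Bool) :
    prodCZ E ψ x = (∏ e ∈ E, edgeSign x e) * ψ x := by
  classical
  induction E using Finset.induction_on generalizing ψ x with
  | empty =>
    have hE : prodCZ (∅ : Finset (Sym2 V)) = 1 := Finset.noncommProd_empty _ _
    rw [hE, Finset.prod_empty, one_mul, Module.End.one_apply]
  | insert e E he ih =>
    have hE : prodCZ (insert e E) = edgeCZ e * prodCZ E :=
      Finset.noncommProd_insert_of_notMem _ _ _ _ he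
    rw [hE, Module.End.mul_apply, edgeCZ_apply, ih, Finset.prod_insert he, mul_assoc]

/-- Signs square to one, so the edges common to `E` and `F` cancel. -/
theorem prod_edgeSign_symmDiff [DecidableEq V] (x : V → Bool) (E F : Finset (Sym2 V)) :
    ∏ e ∈ E ∆ F, edgeSign x e = (∏ e ∈ E, edgeSign x e) * ∏ e ∈ F, edgeSign x e := by
  have hd : Disjoint (E \ F) (F \ E) := disjoint_sdiff_sdiff
  have hI : (∏ e ∈ E ∩ F, edgeSign x e) * ∏ e ∈ E ∩ F, edgeSign x e = 1 := by
    rw [← Finset.prod_mul_distrib]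
    exact Finset.prod_eq_one fun e _ => edgeSign_mul_self x e
  have hE := Finset.prod_inter_mul_prod_sdiff E F (edgeSign x)
  have hF := Finset.prod_inter_mul_prod_sdiff F E (edgeSign x)
  rw [Finset.inter_comm] at hF
  rw [show E ∆ F = E \ F ∪ F \ E from rfl, Finset.prod_union hd, ← hE, ← hF]
  linear_combination (-(∏ e ∈ E \ F, edgeSign x e) * ∏ e ∈ F \ E, edgeSign x e) * hI

theorem prod_edgeSign_star [DecidableEq V] (x : V → Bool) (r : V) (D : Finset V) :
    ∏ e ∈ D.image (fun w => s(r, w)), edgeSign x e =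
      if x r then ∏ w ∈ D, (if x w then -1 else 1) else 1 := by
  rw [Finset.prod_image fun a _ b _ hab => Sym2.congr_right.1 hab]
  cases hr : x r <;> simp [hr]

theorem edgeSign_flipBit_of_notMem [DecidableEq V] (x : V → Bool) {s : V} {e : Sym2 V}
    (hs : s ∉ e) : edgeSign (flipBit s x) e = edgeSign x e := by
  induction e with | _ a b
  rw [Sym2.mem_iff, not_or] at hs
  have ha : flipBit s x a = x a := Function.update_of_ne (Ne.symm hs.1) _ _
  have hb : flipBit s x b = x b := Function.update_of_ne (Ne.symm hs.2) _ _
  rw [edgeSign_mk, edgeSign_mk, ha, hb]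

/-- Flipping a bit changes the sign of a graph state by the parity of its neighbours' bits. -/
theorem prod_edgeSign_flipBit [DecidableEq V] (x : V → Bool) (s : V) (E : Finset (Sym2 V))
    (D : Finset V) (hD : s ∉ D) (hE : ∀ w, s(s, w) ∈ E ↔ w ∈ D) :
    ∏ e ∈ E, edgeSign (flipBit s x) e =
      (∏ e ∈ E, edgeSign x e) * ∏ w ∈ D, (if x w then -1 else 1) := by
  have hsub : D.image (fun w => s(s, w)) ⊆ E := by
    intro e he
    obtain ⟨w, hw, rfl⟩ := Finset.mem_image.1 he
    exact (hE w).2 hw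
  have hrest : ∏ e ∈ E \ D.image (fun w => s(s, w)), edgeSign (flipBit s x) e =
      ∏ e ∈ E \ D.image (fun w => s(s, w)), edgeSign x e := by
    refine Finset.prod_congr rfl fun e he => edgeSign_flipBit_of_notMem x fun hs => ?_
    obtain ⟨w, rfl⟩ := hs
    obtain ⟨h1, h2⟩ := Finset.mem_sdiff.1 he
    exact h2 (Finset.mem_image_of_mem _ ((hE w).1 h1))
  have hflip : ∏ w ∈ D, (if flipBit s x w then (-1 : ℂ) else 1) =
      ∏ w ∈ D, (if x w then -1 else 1) := by
    refine Finset.prod_congr rfl fun w hw => ?_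
    have hws : w ≠ s := fun h => hD (h ▸ hw)
    rw [show flipBit s x w = x w from Function.update_of_ne hws _ _]
  have hsq : (∏ w ∈ D, (if x w then (-1 : ℂ) else 1)) * ∏ w ∈ D, (if x w then -1 else 1) = 1 := by
    rw [← Finset.prod_mul_distrib]
    exact Finset.prod_eq_one fun w _ => by split_ifs <;> norm_num
  have hxs : flipBit s x s = !(x s) := Function.update_self _ _ _
  rw [← Finset.prod_sdiff hsub, ← Finset.prod_sdiff hsub, hrest, prod_edgeSign_star,
    prod_edgeSign_star, hxs, hflip]
  -- Exactly one of the two bits `x s` and `!x s` is set, so only one of the two star products is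
  -- nontrivial. When `x s` is set, that product moves to the other side because it squares to one.
  cases x s
  · simp
  · simp [mul_assoc, hsq]

end Phases

/-! ### A single `CX` as a row addition -/

section OpenGraphStates

variable {V : Type*} [Fintype V] [DecidableEq V]

omit [DecidableEq V] in
theorem mem_edges (G : SimpleGraph V) (a b : V) : s(a, b) ∈ edges G ↔ G.Adj a b := by
  simp [edges]

theorem openGraphState_apply (G : SimpleGraph V) (I : Finset V) (φ : QState I) (x : V → Bool) :
    openGraphState G I φ x = (∏ e ∈ edges G, edgeSign x e) * initialState I φ x :=
  prodCZ_apply _ _ _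

/-- Outside `I` the qubit is in `|+⟩`, which `X` fixes. -/
theorem initialState_flipBit (I : Finset V) (φ : QState I) {s : V} (hs : s ∉ I) (x : V → Bool) :
    initialState I φ (flipBit s x) = initialState I φ x := by
  have hx : (fun i : I => flipBit s x i) = fun i : I => x i := by
    funext i
    have his : (i : V) ≠ s := fun h => hs (h ▸ i.2)
    exact Function.update_of_ne his _ _
  simp only [initialState, hx, plusState]

theorem prodCZ_edgesInside_removeInside (G : SimpleGraph V) (I O : Finset V) (φ : QState I) :
    prodCZ (edgesInside G O) (openGraphState (removeInside G O) I φ) = openGraphState G I φ := by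
  have hE : edges (removeInside G O) = (edges G).filter fun e => ¬ ∀ w ∈ e, w ∈ O := by
    ext e
    simp [edges, removeInside]
  funext x
  rw [prodCZ_apply, openGraphState_apply, openGraphState_apply, hE, edgesInside, ← mul_assoc,
    Finset.prod_filter_mul_prod_filter_not]

/-- The graph without edges inside `O` in which `u ∈ O` has the neighbours `N u \ O`, and which
agrees with `B` off `O`. -/
def rowGraph (O : Finset V) (B : SimpleGraph V) (N : V → Finset V) : SimpleGraph V where
  Adj a b := (a ∈ O ∧ b ∉ O ∧ b ∈ N a) ∨ (a ∉ O ∧ b ∈ O ∧ a ∈ N b) ∨ (a ∉ O ∧ b ∉ O ∧ B.Adj a b)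
  symm := ⟨fun a b hab => by
    rcases hab with h | h | h
    · exact Or.inr (Or.inl ⟨h.2.1, h.1, h.2.2⟩)
    · exact Or.inl ⟨h.2.1, h.1, h.2.2⟩
    · exact Or.inr (Or.inr ⟨h.2.1, h.1, h.2.2.symm⟩)⟩
  loopless := ⟨fun a ha => by
    rcases ha with h | h | h
    · exact h.2.1 h.1
    · exact h.1 h.2.1
    · exact B.loopless.irrefl a h.2.2⟩

omit [Fintype V] [DecidableEq V] in
theorem rowGraph_adj_of_mem {O : Finset V} {B : SimpleGraph V} {N : V → Finset V} {r : V}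
    (hr : r ∈ O) (w : V) : (rowGraph O B N).Adj r w ↔ w ∉ O ∧ w ∈ N r := by
  simp [rowGraph, hr]

omit [Fintype V] in
theorem removeInside_eq_rowGraph (G : SimpleGraph V) (O : Finset V) (N : V → Finset V)
    (hN : ∀ u w, w ∈ N u ↔ G.Adj u w) : removeInside G O = rowGraph O G N := by
  ext a b
  simp only [removeInside, SimpleGraph.deleteEdges_adj, rowGraph, hN, Set.mem_ofPred_eq,
    Sym2.mem_iff, forall_eq_or_imp, forall_eq, G.adj_comm b a]
  tauto

theorem edges_rowGraph_update {O : Finset V} (B : SimpleGraph V) (N : V → Finset V) {r : V}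
    (hr : r ∈ O) (D : Finset V) :
    edges (rowGraph O B (Function.update N r (N r ∆ D))) =
      edges (rowGraph O B N) ∆ (D \ O).image (fun w => s(r, w)) := by
  ext e
  induction e with | _ a b
  simp only [mem_edges, Finset.mem_symmDiff, Finset.mem_image, Finset.mem_sdiff, rowGraph,
    Sym2.eq_iff]
  by_cases har : a = r
  · subst har
    by_cases hbO : b ∈ O
    · grind
    · simp only [hr, hbO, Function.update_self, Finset.mem_symmDiff]
      grind
  · by_cases hbr : b = r
    · subst hbr
      simp only [hr, Function.update_self, Finset.mem_symmDiff]
      grind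
    · simp only [Function.update_of_ne har, Function.update_of_ne hbr]
      grind

/-- Where the bit `r` is set, flipping `s` contributes the signs of the bits in `N s \ O`. These are
the signs of the edges from `r` to that set. -/
theorem CX_openGraphState {O I : Finset V} (B : SimpleGraph V) (N : V → Finset V) {r s : V}
    (hr : r ∈ O) (hs : s ∈ O) (hsI : s ∉ I) (φ : QState I) :
    CX r s (openGraphState (rowGraph O B N) I φ) =
      openGraphState (rowGraph O B (Function.update N r (N r ∆ N s))) I φ := by
  funext x
  have hflip := prod_edgeSign_flipBit x s (edges (rowGraph O B N)) (N s \ O)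
    (by simp [hs]) (fun w => by
      rw [mem_edges, rowGraph_adj_of_mem hs, Finset.mem_sdiff, and_comm])
  rw [CX_apply, openGraphState_apply, openGraphState_apply, openGraphState_apply,
    initialState_flipBit I φ hsI, hflip, edges_rowGraph_update B N hr, prod_edgeSign_symmDiff,
    prod_edgeSign_star]
  cases x r <;> simp

end OpenGraphStates

/-! ### Symmetric differences as linear algebra over the field with two elements -/

section SymmetricSums

variable {V : Type*} [Fintype V] [DecidableEq V]

/-- The indicator of a finite set, with values in the field with two elements. -/
def parity (S : Finset V) (w : V) : ZMod 2 := if w ∈ S then 1 else 0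

omit [Fintype V] in
theorem parity_injective {S T : Finset V} (hST : ∀ w, parity S w = parity T w) : S = T := by
  ext w
  have := hST w
  unfold parity at this
  split_ifs at this <;> simp_all

omit [Fintype V] in
theorem parity_symmDiff (S T : Finset V) (w : V) :
    parity (S ∆ T) w = parity S w + parity T w := by
  unfold parity
  by_cases h1 : w ∈ S <;> by_cases h2 : w ∈ T <;> simp [Finset.mem_symmDiff, h1, h2]
  decide

theorem parity_xorSum (U : Finset V) (g : V → Finset V) (w : V) :
    parity (xorSum U g) w = ∑ u ∈ U, parity (g u) w := by
  have hsum : ∑ u ∈ U, parity (g u) w = ((U.filter fun u => w ∈ g u).card : ZMod 2) := by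
    simp [parity]
  rw [hsum, parity]
  by_cases hodd : Odd (U.filter fun u => w ∈ g u).card
  · rw [if_pos (by simpa [xorSum] using hodd), ZMod.natCast_eq_one_iff_odd.2 hodd]
  · rw [if_neg (by simpa [xorSum] using hodd),
      (ZMod.natCast_eq_zero_iff_even).2 (Nat.not_odd_iff_even.1 hodd)]

theorem xorSum_eq_sum_univ (U : Finset V) (g : V → Finset V) (w : V) :
    parity (xorSum U g) w = ∑ u, parity U u * parity (g u) w := by
  rw [parity_xorSum]
  simp only [parity, ite_mul, one_mul, zero_mul, Finset.sum_ite_mem, Finset.univ_inter]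

theorem xorSum_symmDiff (S T : Finset V) (N : V → Finset V) :
    xorSum (S ∆ T) N = xorSum S N ∆ xorSum T N := by
  refine parity_injective fun w => ?_
  simp only [parity_symmDiff, xorSum_eq_sum_univ, add_mul, Finset.sum_add_distrib]

/-- Associativity of matrix products. With `N` the neighbourhoods of a graph, it makes the odd
neighbourhood linear. -/
theorem xorSum_xorSum (U : Finset V) (g N : V → Finset V) :
    xorSum (xorSum U g) N = xorSum U fun u => xorSum (g u) N := by
  refine parity_injective fun w => ?_
  simp only [xorSum_eq_sum_univ, Finset.sum_mul, Finset.mul_sum, mul_assoc]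
  exact Finset.sum_comm

theorem xorSum_insert {s : V} {S : Finset V} (hs : s ∉ S) (N : V → Finset V) :
    xorSum (insert s S) N = N s ∆ xorSum S N := by
  refine parity_injective fun w => ?_
  rw [parity_symmDiff, parity_xorSum, parity_xorSum, Finset.sum_insert hs]

theorem xorSum_congr {S : Finset V} {N N' : V → Finset V} (h : ∀ s ∈ S, N s = N' s) :
    xorSum S N = xorSum S N' := by
  refine parity_injective fun w => ?_
  rw [parity_xorSum, parity_xorSum]
  exact Finset.sum_congr rfl fun s hs => by rw [h s hs]

theorem xorSum_subset {U : Finset V} {g : V → Finset V} {S : Finset V}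
    (h : ∀ u ∈ U, g u ⊆ S) : xorSum U g ⊆ S := by
  intro w hw
  obtain ⟨u, hu⟩ := Finset.card_pos.1 (Finset.mem_filter.1 hw).2.pos
  exact h u (Finset.mem_filter.1 hu).1 (Finset.mem_filter.1 hu).2

theorem mem_xorSum_iff_of_singleton {U : Finset V} {g : V → Finset V} {a : V}
    (h : ∀ u ∈ U, a ∈ g u ↔ a = u) : a ∈ xorSum U g ↔ a ∈ U := by
  have hU : (U.filter fun u => a ∈ g u) = U.filter fun u => a = u := Finset.filter_congr h
  rw [xorSum, Finset.mem_filter, hU, Finset.filter_eq]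
  by_cases ha : a ∈ U <;> simp [ha]

end SymmetricSums

/-! ### Sequences of multi-target `CX` gates -/

section RowOperations

variable {V : Type*} [Fintype V] [DecidableEq V]

omit [Fintype V] in
theorem CXSet_insert {r s : V} {S : Finset V} (hs : s ∉ S) (hsr : s ≠ r) :
    CXSet r (insert s S) = CX r s * CXSet r S := by
  have he : (insert s S).erase r = insert s (S.erase r) := Finset.erase_insert_of_ne hsr
  have hs' : s ∉ S.erase r := fun h => hs (Finset.mem_of_mem_erase h)
  unfold CXSet
  simp only [he]
  exact Finset.noncommProd_insert_of_notMem _ _ _ _ hs'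

/-- As `r ∉ S`, the rows being added stay unchanged while row `r` accumulates them. -/
theorem CXSet_openGraphState {O I : Finset V} (B : SimpleGraph V) (N : V → Finset V) {r : V}
    (hr : r ∈ O) (S : Finset V) (hrS : r ∉ S) (hS : S ⊆ O) (hI : S ⊆ Iᶜ) (φ : QState I) :
    CXSet r S (openGraphState (rowGraph O B N) I φ) =
      openGraphState (rowGraph O B (Function.update N r (N r ∆ xorSum S N))) I φ := by
  induction S using Finset.induction_on with
  | empty =>
    have hx : xorSum ∅ N = ∅ := Finset.subset_empty.1 (xorSum_subset (by simp))
    rw [hx, show (∅ : Finset V) = ⊥ from rfl, symmDiff_bot, Function.update_eq_self]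
    simp [CXSet, Finset.noncommProd_empty]
  | insert s S hs ih =>
    rw [Finset.insert_subset_iff] at hS hI
    rw [Finset.mem_insert, not_or] at hrS
    have hsr : s ≠ r := Ne.symm hrS.1
    rw [CXSet_insert hs hsr, Module.End.mul_apply, ih hrS.2 hS.2 hI.2,
      CX_openGraphState _ _ hr hS.1 (Finset.mem_compl.1 hI.1), Function.update_self,
      Function.update_idem, Function.update_of_ne hsr, xorSum_insert hs, symmDiff_assoc,
      symmDiff_comm (N s)]

/-- A sequence of multi-target `CX` gates acts on an open graph state without edges inside `O` by
replacing the neighbourhoods of the controls. -/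
theorem prod_CXSet_openGraphState {O I : Finset V} (B : SimpleGraph V) (N : V → Finset V) {n : ℕ}
    (r : Fin n → V) (S : Fin n → Finset V) (hS : ∀ m, S m ⊆ O) (hI : ∀ m, S m ⊆ Iᶜ)
    (hr : ∀ m, r m ∈ S m) (hlt : ∀ j m, j < m → r j ∉ S m) :
    ∃ N' : V → Finset V,
      (∀ m, N' (r m) = xorSum (S m) N) ∧ (∀ w, (∀ m, w ≠ r m) → N' w = N w) ∧
      ∀ φ : QState I, (List.ofFn fun m => CXSet (r m) (S m ∆ {r m})).reverse.prod
        (openGraphState (rowGraph O B N) I φ) = openGraphState (rowGraph O B N') I φ := by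
  induction n with
  | zero => exact ⟨N, fun m => m.elim0, fun _ _ => rfl, fun φ => by simp⟩
  | succ n ih =>
    obtain ⟨N', h1, h2, h3⟩ := ih (fun m => r m.castSucc) (fun m => S m.castSucc)
      (fun m => hS _) (fun m => hI _) (fun m => hr _)
      (fun j m hjm => hlt _ _ (Fin.castSucc_lt_castSucc_iff.2 hjm))
    -- The last control lies in its own set, which avoids all earlier controls.
    have hne : ∀ m : Fin n, r m.castSucc ≠ r (Fin.last n) := fun m h =>
      hlt _ _ (Fin.castSucc_lt_last m) (h ▸ hr (Fin.last n))
    have herase : S (Fin.last n) ∆ {r (Fin.last n)} = (S (Fin.last n)).erase (r (Fin.last n)) := by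
      ext w
      by_cases hw : w = r (Fin.last n)
      · simp [hw, Finset.mem_symmDiff, hr]
      · simp [hw, Finset.mem_symmDiff]
    -- The control's own row supplies the erased term, and no row indexed by the last set has been
    -- modified yet.
    have hsum : N' (r (Fin.last n)) ∆ xorSum ((S (Fin.last n)).erase (r (Fin.last n))) N' =
        xorSum (S (Fin.last n)) N := by
      rw [← xorSum_insert (Finset.notMem_erase _ _), Finset.insert_erase (hr _)]
      refine xorSum_congr fun s hs => h2 s fun m hm => ?_
      exact hlt _ _ (Fin.castSucc_lt_last m) (hm ▸ hs)
    refine ⟨Function.update N' (r (Fin.last n)) (xorSum (S (Fin.last n)) N), fun m => ?_,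
      fun w hw => ?_, fun φ => ?_⟩
    · induction m using Fin.lastCases with
      | last => rw [Function.update_self]
      | cast m => rw [Function.update_of_ne (hne m), h1]
    · rw [Function.update_of_ne (hw _), h2 w fun m => hw _]
    · rw [List.ofFn_succ', List.concat_eq_append, List.reverse_append, List.reverse_singleton,
        List.prod_append, List.prod_singleton, Module.End.mul_apply, h3, herase,
        CXSet_openGraphState _ _ (hS _ (hr _)) _ (Finset.notMem_erase _ _)
          ((Finset.erase_subset _ _).trans (hS _)) ((Finset.erase_subset _ _).trans (hI _)), hsum]

end RowOperations

/-! ### The first two layers of a maximally delayed gflow -/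

section Layers

variable {V : Type*} [Fintype V] [DecidableEq V]

theorem mem_maxOf {prec : V → V → Prop} {X : Finset V} {u : V} :
    u ∈ maxOf prec X ↔ u ∈ X ∧ ∀ v ∈ X, ¬ prec u v := by
  classical
  simp only [maxOf, Finset.mem_filter]

theorem mem_oddNbhd_iff_xorSum {G : SimpleGraph V} {S : Finset V} {N : V → Finset V}
    (hN : ∀ u w, w ∈ N u ↔ G.Adj u w) {w : V} : w ∈ oddNbhd G S ↔ w ∈ xorSum S N := by
  classical
  simp only [oddNbhd, xorSum, Finset.mem_filter, hN]

/-- Fewer relations leave fewer obstructions to being maximal, so vertices enter layers no later. -/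
theorem layersBelow_mono_of_imp {prec prec' : V → V → Prop} (himp : ∀ a b, prec' a b → prec a b)
    (k : ℕ) : layersBelow prec k ⊆ layersBelow prec' k := by
  induction k with
  | zero => exact Finset.Subset.refl _
  | succ k ih =>
    intro u hu
    by_cases hu' : u ∈ layersBelow prec' k
    · exact Finset.mem_union_left _ hu'
    · refine Finset.mem_union_right _ (mem_maxOf.2 ⟨Finset.mem_compl.2 hu', ?_⟩)
      intro v hv huv
      rcases Finset.mem_union.1 hu with h | h
      · exact hu' (ih h)
      · refine (mem_maxOf.1 h).2 v (Finset.mem_compl.2 fun hvk => ?_) (himp _ _ huv)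
        exact Finset.mem_compl.1 hv (ih hvk)

theorem mem_layersBelow_one (prec : V → V → Prop) (u : V) :
    u ∈ layersBelow prec 1 ↔ ∀ v, ¬ prec u v := by
  simp [layersBelow, mem_maxOf]

theorem IsGflow.exists_prec {G : SimpleGraph V} {I O : Finset V} {g : V → Finset V}
    {prec : V → V → Prop} (hg : IsGflow G I O g prec) {u : V} (hu : u ∉ O) : ∃ w, prec u w := by
  classical
  have hne : (g u).Nonempty := by
    by_contra hemp
    have hmem := hg.g2 u hu
    rw [Finset.not_nonempty_iff_eq_empty.1 hemp] at hmem
    simp [oddNbhd] at hmem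
  obtain ⟨w, hw⟩ := hne
  exact ⟨w, hg.g1 u hu w hw⟩

/-- The first layer of a maximally delayed gflow is the set of outputs. -/
theorem IsMaxDelayedGflow.layersBelow_one {G : SimpleGraph V} {I O : Finset V}
    {g : V → Finset V} {prec : V → V → Prop} (hg : IsMaxDelayedGflow G I O g prec) :
    layersBelow prec 1 = O := by
  obtain ⟨hgf, hmax⟩ := hg
  have hsub : layersBelow prec 1 ⊆ O := by
    intro u hu
    by_contra huO
    obtain ⟨w, hw⟩ := hgf.exists_prec huO
    exact (mem_layersBelow_one prec u).1 hu w hw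
  by_contra hne
  -- Dropping the relations that start at outputs keeps a gflow and puts every output in layer
  -- `V_0`. If `V_0` were not already `O`, the result would be more delayed, strictly so at index 0.
  let prec' : V → V → Prop := fun a b => a ∉ O ∧ prec a b
  have hgf' : IsGflow G I O g prec' :=
    { irrefl := fun u hu => hgf.irrefl u hu.2
      trans := fun u v w huv hvw => ⟨huv.1, hgf.trans u v w huv.2 hvw.2⟩
      maps := hgf.maps
      g1 := fun u hu v hv => ⟨hu, hgf.g1 u hu v hv⟩
      g2 := hgf.g2
      g3 := fun u hu v hv => (hgf.g3 u hu v hv).imp id fun h => ⟨hu, h⟩ }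
  have hO : O ⊆ layersBelow prec' 1 := fun u hu =>
    (mem_layersBelow_one prec' u).2 fun v hv => hv.1 hu
  refine hmax g prec' hgf' ⟨fun k => Finset.card_le_card
    (layersBelow_mono_of_imp (fun _ _ h => h.2) _), 0, ?_⟩
  exact (Finset.card_lt_card (hsub.ssubset_of_ne hne)).trans_le (Finset.card_le_card hO)

theorem IsMaxDelayedGflow.mem_layer_one {G : SimpleGraph V} {I O : Finset V}
    {g : V → Finset V} {prec : V → V → Prop} (hg : IsMaxDelayedGflow G I O g prec) {u : V} :
    u ∈ layer prec 1 ↔ u ∉ O ∧ ∀ w, prec u w → w ∈ O := by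
  rw [layer, hg.layersBelow_one, mem_maxOf, Finset.mem_compl]
  refine and_congr_right fun _ => forall_congr' fun w => ?_
  rw [Finset.mem_compl]
  tauto

theorem IsMaxDelayedGflow.subset_of_mem_layer_one {G : SimpleGraph V} {I O : Finset V}
    {g : V → Finset V} {prec : V → V → Prop} (hg : IsMaxDelayedGflow G I O g prec) {u : V}
    (hu : u ∈ layer prec 1) : g u ⊆ O := fun w hw =>
  (hg.mem_layer_one.1 hu).2 w (hg.1.g1 u (hg.mem_layer_one.1 hu).1 w hw)

/-- Any other element of the odd neighbourhood comes after `u`, and only outputs come after a vertex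
of `V_1`. -/
theorem IsMaxDelayedGflow.mem_oddNbhd_iff {G : SimpleGraph V} {I O : Finset V}
    {g : V → Finset V} {prec : V → V → Prop} (hg : IsMaxDelayedGflow G I O g prec) {u : V}
    (hu : u ∈ layer prec 1) {a : V} (ha : a ∉ O) : a ∈ oddNbhd G (g u) ↔ a = u := by
  obtain ⟨huO, hmax⟩ := hg.mem_layer_one.1 hu
  constructor
  · intro h
    rcases hg.1.g3 u huO a h with h | h
    · exact h.symm
    · exact absurd (hmax a h) ha
  · rintro rfl
    exact hg.1.g2 a huO

end Layers

/-- A graph has a flow from `A`, enumerated by `v`, to its image under `h` if each `h (v m)` is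
adjacent to `v m` and otherwise only to earlier vertices of the enumeration. -/
theorem hasFlow_induce_of_enumeration {V : Type*} [DecidableEq V] (H : SimpleGraph V)
    {n : ℕ} (v : Fin n → V) (hv : Function.Injective v) (h : V → V) (A : Finset V)
    (hA : Finset.univ.image v = A) (hdisj : ∀ u ∈ A, h u ∉ A)
    (hadj : ∀ m, H.Adj (h (v m)) (v m))
    (hnb : ∀ m w, H.Adj (h (v m)) w → w = v m ∨ ∃ j < m, w = v j) :
    HasFlow (H.induce {w | w ∈ A ∪ A.image h}) {w | (w : V) ∈ A} {w | (w : V) ∈ A.image h} := by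
  have hvA : ∀ m, v m ∈ A := fun m => hA ▸ Finset.mem_image_of_mem v (Finset.mem_univ m)
  have hAv : ∀ u ∈ A, ∃ m, u = v m := by
    intro u hu
    rw [← hA] at hu
    obtain ⟨m, -, hm⟩ := Finset.mem_image.1 hu
    exact ⟨m, hm.symm⟩
  have hout : ∀ w : {w | w ∈ A ∪ A.image h},
      w ∉ {w : {w | w ∈ A ∪ A.image h} | (w : V) ∈ A.image h} → (w : V) ∈ A := by
    rintro ⟨w, hw⟩ hw'
    exact (Finset.mem_union.1 hw).resolve_right hw'
  refine ⟨fun w => if hw : (w : V) ∈ A then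
      ⟨h w, Finset.mem_union_right _ (Finset.mem_image_of_mem h hw)⟩ else w,
    fun a b => ∃ m, (a : V) = v m ∧ ((b : V) ∉ A ∨ ∃ j < m, (b : V) = v j), ?_⟩
  refine ⟨?_, ?_, ?_, ?_, ?_, ?_⟩
  · rintro u ⟨m, hm, h' | ⟨j, hj, h'⟩⟩
    · exact h' (hm ▸ hvA m)
    · exact hj.ne (hv (h'.symm.trans hm))
  · rintro u x w ⟨m, hm, hx⟩ ⟨k, hk, hw⟩
    refine ⟨m, hm, hw.imp id ?_⟩
    rintro ⟨i, hi, hwi⟩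
    rcases hx with hx | ⟨j, hj, hx⟩
    · exact absurd (hk ▸ hvA k) hx
    · exact ⟨i, hi.trans ((hv (hk.symm.trans hx)) ▸ hj), hwi⟩
  · intro u hu
    simp only [hout u hu, dif_pos, Set.mem_ofPred_eq]
    exact hdisj _ (hout u hu)
  · intro u hu
    obtain ⟨m, hm⟩ := hAv _ (hout u hu)
    refine ⟨m, hm, Or.inl ?_⟩
    simp only [hout u hu, dif_pos]
    exact hdisj _ (hout u hu)
  · intro u hu
    obtain ⟨m, hm⟩ := hAv _ (hout u hu)
    simp only [hout u hu, dif_pos, SimpleGraph.comap_adj, Function.Embedding.subtype_apply]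
    rw [hm]
    exact hadj m
  · intro u hu w hw
    obtain ⟨m, hm⟩ := hAv _ (hout u hu)
    simp only [hout u hu, dif_pos, SimpleGraph.comap_adj, Function.Embedding.subtype_apply] at hw
    rw [hm] at hw
    rcases hnb m w hw with h' | h'
    · exact Or.inl (Subtype.ext (hm.trans h'.symm))
    · exact Or.inr ⟨m, hm, Or.inr h'⟩

end GflowToFlow

open GflowToFlow

/-! ### Assembly of the main theorem -/

theorem mainTheorem4 {V : Type*} [Fintype V] [DecidableEq V] (G : SimpleGraph V) (I O : Finset V)
    (g : V → Finset V) (prec : V → V → Prop) (hg : GflowToFlow.IsMaxDelayedGflow G I O g prec)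
    {n : ℕ} (v : Fin n → V) (gV : V → Finset V) (precV : V → V → Prop) (h : V → V)
    (hV : GflowToFlow.IsMatchingGflow G O g prec v gV precV h) :
    (∀ φ : GflowToFlow.QState I,
      GflowToFlow.prodCZ (GflowToFlow.edgesInside G O)
          (GflowToFlow.openGraphState (GflowToFlow.removeInside G O) I φ) =
        GflowToFlow.openGraphState G I φ) ∧
    ∃ H : SimpleGraph V,
      (∀ φ : GflowToFlow.QState I,
        (List.ofFn fun m : Fin n => GflowToFlow.CXSet (h (v m)) (gV (v m) ∆ {h (v m)})).reverse.prod
            (GflowToFlow.openGraphState (GflowToFlow.removeInside G O) I φ) =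
          GflowToFlow.openGraphState H I φ) ∧
      (∀ r ∈ (GflowToFlow.layer prec 1).image h, ∀ w, H.Adj r w → w ∈ GflowToFlow.layer prec 1) ∧
      GflowToFlow.HasFlow
        (H.induce {w | w ∈ GflowToFlow.layer prec 1 ∪ (GflowToFlow.layer prec 1).image h})
        {w | (w : V) ∈ GflowToFlow.layer prec 1}
        {w | (w : V) ∈ (GflowToFlow.layer prec 1).image h} := by
  classical
  refine ⟨fun φ => prodCZ_edgesInside_removeInside G I O φ, ?_⟩
  obtain ⟨hinj, himg, U, hU, hR, hgV, -, hh, -⟩ := hV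
  have hvL : ∀ m, v m ∈ layer prec 1 := fun m =>
    himg ▸ Finset.mem_image_of_mem v (Finset.mem_univ m)
  have hvO : ∀ m, v m ∉ O := fun m => (hg.mem_layer_one.1 (hvL m)).1
  have hUv : ∀ m, ∀ u ∈ U m, ∃ j < m, u = v j := by
    intro m u hu
    obtain ⟨j, hj, hju⟩ := Finset.mem_image.1 (hU m hu)
    exact ⟨j, Finset.mem_Iio.1 hj, hju.symm⟩
  have hUL : ∀ m, ∀ u ∈ U m, u ∈ layer prec 1 := by
    intro m u hu
    obtain ⟨j, -, rfl⟩ := hUv m u hu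
    exact hvL j
  have hsub : ∀ S : Finset V, (∀ u ∈ layer prec 1, g u ⊆ S) → ∀ m, gV (v m) ⊆ S := by
    intro S hS m w hw
    rw [hgV, Finset.mem_symmDiff] at hw
    rcases hw with hw | hw
    · exact hS _ (hvL m) hw.1
    · exact xorSum_subset (fun u hu => hS u (hUL m u hu)) hw.1
  have hgO : ∀ m, gV (v m) ⊆ O := hsub O fun u hu => hg.subset_of_mem_layer_one hu
  have hgI : ∀ m, gV (v m) ⊆ Iᶜ := hsub Iᶜ fun u hu => hg.1.maps u (hg.mem_layer_one.1 hu).1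
  have hlt : ∀ j m, j < m → h (v j) ∉ gV (v m) := by
    intro j m hjm hmem
    have hj : h (v j) ∈ (Finset.Iio m).image fun j => h (v j) :=
      Finset.mem_image_of_mem (fun j => h (v j)) (Finset.mem_Iio.2 hjm)
    have hiff := Finset.ext_iff.1 (hR m) (h (v j))
    simp only [Finset.mem_inter, hj, true_and] at hiff
    rw [hgV, Finset.mem_symmDiff] at hmem
    tauto
  let N : V → Finset V := fun u => Finset.univ.filter fun w => G.Adj u w
  have hodd : ∀ S, xorSum S N = oddNbhd G S := fun S => by
    ext w
    exact (mem_oddNbhd_iff_xorSum fun u w => by simp [N]).symm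
  obtain ⟨N', hN', -, hstate⟩ := prod_CXSet_openGraphState (I := I) G N (fun m => h (v m))
    (fun m => gV (v m)) hgO hgI (fun m => (hh m).1) hlt
  -- Off `O`, linearity turns the row into `{v m} ∆ U m`, which is a union because `v m ∉ U m`.
  have hN'iff : ∀ m a, a ∉ O → (a ∈ N' (h (v m)) ↔ a = v m ∨ a ∈ U m) := by
    intro m a ha
    have hvU : v m ∉ U m := fun hmem => by
      obtain ⟨j, hj, hjv⟩ := hUv m _ hmem
      exact hj.ne (hinj hjv.symm)
    rw [hN', hgV, xorSum_symmDiff, xorSum_xorSum, Finset.mem_symmDiff, hodd,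
      hg.mem_oddNbhd_iff (hvL m) ha, mem_xorSum_iff_of_singleton fun u hu => by
        rw [hodd, hg.mem_oddNbhd_iff (hUL m u hu) ha]]
    grind
  have hHadj : ∀ m w, (rowGraph O G N').Adj (h (v m)) w ↔ w ∉ O ∧ (w = v m ∨ w ∈ U m) := by
    intro m w
    rw [rowGraph_adj_of_mem (hgO m (hh m).1)]
    exact and_congr_right fun hw => hN'iff m w hw
  refine ⟨rowGraph O G N', fun φ => ?_, fun r hr w hw => ?_, ?_⟩
  · rw [removeInside_eq_rowGraph G O N fun u w => by simp [N]]
    exact hstate φ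
  · rw [← himg, Finset.image_image] at hr
    obtain ⟨m, -, rfl⟩ := Finset.mem_image.1 hr
    rcases ((hHadj m w).1 hw).2 with rfl | hwU
    · exact hvL m
    · exact hUL m w hwU
  · refine hasFlow_induce_of_enumeration _ v hinj h _ himg (fun u hu hu' => ?_)
      (fun m => (hHadj m _).2 ⟨hvO m, Or.inl rfl⟩) fun m w hw => ?_
    · rw [← himg] at hu
      obtain ⟨m, -, rfl⟩ := Finset.mem_image.1 hu
      exact (hg.mem_layer_one.1 hu').1 (hgO m (hh m).1)
    · exact ((hHadj m w).1 hw).2.imp id (hUv m w)
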